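/- Let $n$ be a natural number and $p$ a prime. Let $UT_n(R)$ denote the group of upper unitriangular $n\times n$ matrices over a commutative ring $R$, and let $G=\mathbb{Z}^n\ltimes UT_n(\mathbb{Z}[1/p])$ be the discrete group with product $(x,f)(y,g)=(x+y,\,f\,XgX^{-1})$, where $X=\mathrm{diag}(p^{x_1},\dots,p^{x_n})$. Let $|\cdot|$ be the word length on $G$ with respect to the generators $(e_i,I)$ for $1\le i\le n$ and $(0,I+E_{ij})$ for $1\le i<j\le n$, and their inverses. Let $\mu$ be a probability measure on $G$ with finite first moment, $\int_G |g|\,d\mu(g)<\infty$, such that the group generated by the support of $\mu$ is non-abelian. Let $D_{ij}=m_i-m_j$ be the displacement matrix of $\mu$, where $m_i$ is the mean of $x_i$ when $(x,f)$ has law $\mu$. Let $(x^{(r)},f^{(r)})_{r\ge1}$ be independent with law $\mu$, and let $$(y^{(m)},\varphi^{(m)})=(x^{(1)},f^{(1)})\cdots(x^{(m)},f^{(m)})$$ be the right random walk. (a) Let $1\le i<j\le n$ be such that $D_{ij}>0$ and $\operatorname{sgn}D_{kj}=\operatorname{sgn}D_{ij}$ for all $k$ with $i<k<j$. Then almost surely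 the sequence of entries $\varphi^{(m)}_{ij}$ converges in $\mathbb{Q}_p$. (b) If $D_{ij}>0$ for all $1\le i<j\le n$, then almost surely the matrices $\varphi^{(m)}$ converge entrywise in $\mathbb{Q}_p$ to a matrix $\varphi^{(\infty)}\in UT_n(\mathbb{Q}_p)$. -/

import Mathlib

open MeasureTheory Filter Topology

open scoped ENNReal

noncomputable section

namespace SolvableWalk

/-- The ring `ℤ[1/p]` of all rationals `a / p ^ m` with `a ∈ ℤ` and `m ∈ ℕ`. -/
def pAdicInt (p : ℕ) [Fact p.Prime] : Subring ℚ where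
  carrier := {q | ∃ (a : ℤ) (m : ℕ), q = a / (p : ℚ) ^ m}
  mul_mem' := by
    rintro _ _ ⟨a, m, rfl⟩ ⟨b, k, rfl⟩
    refine ⟨a * b, m + k, ?_⟩
    rw [div_mul_div_comm, pow_add]
    push_cast
    rfl
  one_mem' := ⟨1, 0, by simp⟩
  add_mem' := by
    rintro _ _ ⟨a, m, rfl⟩ ⟨b, k, rfl⟩
    have hp : (p : ℚ) ≠ 0 := Nat.cast_ne_zero.2 (Fact.out : p.Prime).ne_zero
    refine ⟨a * p ^ k + p ^ m * b, m + k, ?_⟩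
    rw [div_add_div _ _ (pow_ne_zero _ hp) (pow_ne_zero _ hp), pow_add]
    push_cast
    rfl
  zero_mem' := ⟨0, 0, by simp⟩
  neg_mem' := by
    rintro _ ⟨a, m, rfl⟩
    exact ⟨-a, m, by push_cast; rw [neg_div]⟩

/-- The prime `p`, as a unit of `ℤ[1/p]`. -/
def pUnit (p : ℕ) [Fact p.Prime] : (pAdicInt p)ˣ where
  val := ⟨p, p, 0, by simp⟩
  inv := ⟨(p : ℚ)⁻¹, 1, 1, by simp⟩
  val_inv := Subtype.ext (mul_inv_cancel₀ (Nat.cast_ne_zero.2 (Fact.out : p.Prime).ne_zero))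
  inv_val := Subtype.ext (inv_mul_cancel₀ (Nat.cast_ne_zero.2 (Fact.out : p.Prime).ne_zero))

/-- The group `UT_n(R)` of upper unitriangular `n × n` matrices over `R`. -/
def UT (n : ℕ) (R : Type*) [CommRing R] : Subgroup (GL (Fin n) R) where
  carrier := {A | (∀ i, A.val i i = 1) ∧ ∀ i j, j < i → A.val i j = 0}
  one_mem' := ⟨fun i => by simp, fun i j h => by simp [h.ne']⟩
  mul_mem' := by
    rintro A B ⟨hA, hA'⟩ ⟨hB, hB'⟩
    constructor
    · intro i
      rw [Units.val_mul, Matrix.mul_apply, Finset.sum_eq_single i]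
      · rw [hA, hB, mul_one]
      · intro k _ hk
        rcases lt_or_gt_of_ne hk with h | h
        · rw [hA' i k h, zero_mul]
        · rw [hB' k i h, mul_zero]
      · simp
    · intro i j hij
      rw [Units.val_mul, Matrix.mul_apply]
      refine Finset.sum_eq_zero fun k _ => ?_
      rcases lt_or_ge k i with h | h
      · rw [hA' i k h, zero_mul]
      · rw [hB' k j (hij.trans_le h), mul_zero]
  inv_mem' := by
    rintro A ⟨hA, hA'⟩
    have key : ∀ i j, j < i → A⁻¹.val i j = 0 := by
      have : Invertible A.val := A.invertible
      have h : A.val.BlockTriangular id := fun i j hij => hA' i j hij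
      have h' := Matrix.blockTriangular_inv_of_blockTriangular h
      intro i j hij
      rw [Matrix.coe_units_inv]
      exact h' hij
    refine ⟨fun i => ?_, key⟩
    have h1 : (A.val * A⁻¹.val) i i = 1 := by
      rw [← Units.val_mul, mul_inv_cancel, Units.val_one, Matrix.one_apply_eq]
    rw [Matrix.mul_apply, Finset.sum_eq_single i] at h1
    · rwa [hA, one_mul] at h1
    · intro k _ hk
      rcases lt_or_gt_of_ne hk with h | h
      · rw [hA' i k h, zero_mul]
      · rw [key k i h, mul_zero]
    · simp

/-- The diagonal matrix `diag(p ^ x₁, …, p ^ xₙ)`, as a homomorphism in `x ∈ ℤⁿ` (written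
multiplicatively). -/
def diagPow (n p : ℕ) [Fact p.Prime] : Multiplicative (Fin n → ℤ) →* GL (Fin n) (pAdicInt p) where
  toFun x :=
    { val := Matrix.diagonal fun i => ((pUnit p ^ (x.toAdd i) : (pAdicInt p)ˣ) : pAdicInt p)
      inv := Matrix.diagonal fun i => ((pUnit p ^ (-(x.toAdd i)) : (pAdicInt p)ˣ) : pAdicInt p)
      val_inv := by
        rw [Matrix.diagonal_mul_diagonal, ← Matrix.diagonal_one]
        congr 1
        funext i
        rw [← Units.val_mul, ← zpow_add, add_neg_cancel, zpow_zero, Units.val_one]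
      inv_val := by
        rw [Matrix.diagonal_mul_diagonal, ← Matrix.diagonal_one]
        congr 1
        funext i
        rw [← Units.val_mul, ← zpow_add, neg_add_cancel, zpow_zero, Units.val_one] }
  map_one' := by
    ext i j
    simp [Matrix.diagonal_apply, Matrix.one_apply]
  map_mul' x y := by
    apply Units.ext
    change Matrix.diagonal _ = Matrix.diagonal _ * Matrix.diagonal _
    rw [Matrix.diagonal_mul_diagonal]
    congr 1
    funext i
    rw [← Units.val_mul, ← zpow_add]
    rfl

/-- Conjugation by `diag(p ^ x₁, …, p ^ xₙ)` preserves `UT_n(ℤ[1/p])`. -/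
theorem conj_mem_UT {n p : ℕ} [Fact p.Prime] (x : Multiplicative (Fin n → ℤ))
    {f : GL (Fin n) (pAdicInt p)} (hf : f ∈ UT n (pAdicInt p)) :
    diagPow n p x * f * (diagPow n p x)⁻¹ ∈ UT n (pAdicInt p) := by
  have key : ∀ i j, (diagPow n p x * f * (diagPow n p x)⁻¹).val i j =
      ((pUnit p ^ (x.toAdd i) : (pAdicInt p)ˣ) : pAdicInt p) * f.val i j *
        ((pUnit p ^ (-(x.toAdd j)) : (pAdicInt p)ˣ) : pAdicInt p) := by
    intro i j
    change (Matrix.diagonal _ * f.val * Matrix.diagonal _ : Matrix _ _ _) i j = _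
    rw [Matrix.mul_diagonal, Matrix.diagonal_mul]
  refine ⟨fun i => ?_, fun i j hij => ?_⟩
  · rw [key, hf.1 i, mul_one, ← Units.val_mul, ← zpow_add, add_neg_cancel, zpow_zero,
      Units.val_one]
  · rw [key, hf.2 i j hij, mul_zero, zero_mul]

/-- The action `ζ` of `ℤⁿ` on `UT_n(ℤ[1/p])`: `ζ_x(f) = X f X⁻¹` with
`X = diag(p ^ x₁, …, p ^ xₙ)`. -/
def zeta (n p : ℕ) [Fact p.Prime] : Multiplicative (Fin n → ℤ) →* MulAut (UT n (pAdicInt p)) where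
  toFun x :=
    { toFun := fun f => ⟨diagPow n p x * f * (diagPow n p x)⁻¹, conj_mem_UT x f.2⟩
      invFun := fun f => ⟨diagPow n p x⁻¹ * f * (diagPow n p x⁻¹)⁻¹, conj_mem_UT x⁻¹ f.2⟩
      left_inv := fun f => Subtype.ext (by simp [mul_assoc])
      right_inv := fun f => Subtype.ext (by simp [mul_assoc])
      map_mul' := fun f g => Subtype.ext (by simp [mul_assoc]) }
  map_one' := by
    ext1 f
    exact Subtype.ext (by simp)
  map_mul' x y := by
    ext1 f
    exact Subtype.ext (by simp [mul_assoc])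

/-- The group `ℤⁿ ⋉ UT_n(ℤ[1/p])`, with product `(x, f) (y, g) = (x + y, f ζ_x(g))`.
The component `x` of an element is its `right` and the component `f` its `left`. -/
abbrev Gex (n p : ℕ) [Fact p.Prime] : Type :=
  UT n (pAdicInt p) ⋊[zeta n p] Multiplicative (Fin n → ℤ)

/-- The coordinate `x_i` of `(x, f)`. -/
def expo {n p : ℕ} [Fact p.Prime] (i : Fin n) (g : Gex n p) : ℤ := g.right.toAdd i

/-- The entry `f_{ij} ∈ ℤ[1/p] ⊆ ℚ` of `(x, f)`. -/
def entry {n p : ℕ} [Fact p.Prime] (i j : Fin n) (g : Gex n p) : ℚ := (g.left.val.val i j).val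

/-- The group is discrete. -/
instance (n p : ℕ) [Fact p.Prime] : MeasurableSpace (Gex n p) := ⊤

instance (n p : ℕ) [Fact p.Prime] : DiscreteMeasurableSpace (Gex n p) := ⟨fun _ => trivial⟩

instance (n p : ℕ) [Fact p.Prime] : Countable (Gex n p) := by
  have h : Function.Injective fun g : Gex n p =>
      ((fun i j => entry i j g, fun i => expo i g) : (Fin n → Fin n → ℚ) × (Fin n → ℤ)) := by
    intro g h hgh
    obtain ⟨h1, h2⟩ := Prod.ext_iff.1 hgh
    refine SemidirectProduct.ext (Subtype.ext (Units.ext (Matrix.ext fun i j => ?_))) ?_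
    · exact Subtype.ext (congrFun (congrFun h1 i) j)
    · exact Multiplicative.toAdd.injective (funext fun i => congrFun h2 i)
  exact h.countable

/-- The standard generators: `(e_i, I)`, which represents the diagonal matrix with `p` at place
`i`, and `(0, I + E_{ij})` with `i < j`. -/
def generators (n p : ℕ) [Fact p.Prime] : Set (Gex n p) :=
  {g | g.left = 1 ∧ ∃ i, g.right.toAdd = Pi.single i 1} ∪
    {g | g.right = 1 ∧ ∃ i j, i < j ∧ g.left.val.val = 1 + Matrix.single i j 1}

/-- The word length of `g` with respect to `S`: the least length of a word in the elements of `S`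
and their inverses that represents `g` (`⊤` if there is none). -/
def wordLength {G : Type*} [Group G] (S : Set G) (g : G) : ℕ∞ :=
  ⨅ (l : List G) (_ : (∀ s ∈ l, s ∈ S ∨ s⁻¹ ∈ S) ∧ l.prod = g), (l.length : ℕ∞)

/-- Finite first moment with respect to word length. -/
def FiniteFirstMoment {n p : ℕ} [Fact p.Prime] (μ : Measure (Gex n p)) : Prop :=
  ∫⁻ g, (wordLength (generators n p) g : ℝ≥0∞) ∂μ < ∞

/-- The support of a measure on the (countable, discrete) group. -/
def supp {n p : ℕ} [Fact p.Prime] (μ : Measure (Gex n p)) : Set (Gex n p) := {g | μ {g} ≠ 0}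

/-- The group generated by the support of `μ` is non-abelian. -/
def NonAbelianSupport {n p : ℕ} [Fact p.Prime] (μ : Measure (Gex n p)) : Prop :=
  ∃ g ∈ Subgroup.closure (supp μ), ∃ h ∈ Subgroup.closure (supp μ), g * h ≠ h * g

/-- The mean of the pushforward of `μ` to `ℤ` under `(x, f) ↦ x_i`. -/
def drift {n p : ℕ} [Fact p.Prime] (μ : Measure (Gex n p)) (i : Fin n) : ℝ :=
  ∫ z : ℤ, (z : ℝ) ∂(μ.map (expo i))

/-- The displacement matrix `D_{ij} = drift_i - drift_j`. -/
def displacement {n p : ℕ} [Fact p.Prime] (μ : Measure (Gex n p)) : Matrix (Fin n) (Fin n) ℝ :=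
  Matrix.of fun i j => drift μ i - drift μ j

/-- The map from increments to paths: the place `m` of the path is the product
`ω_0 ω_1 ⋯ ω_m` of the first `m + 1` increments. -/
def pathMap {G : Type*} [Group G] (ω : ℕ → G) (m : ℕ) : G :=
  (List.ofFn fun k : Fin (m + 1) => ω k).prod

theorem pathMap_succ {G : Type*} [Group G] (ω : ℕ → G) (m : ℕ) :
    pathMap ω (m + 1) = pathMap ω m * ω (m + 1) := by
  simp only [pathMap]
  rw [List.ofFn_succ', List.concat_eq_append, List.prod_append]
  simp

theorem measurable_pathMap (n p : ℕ) [Fact p.Prime] :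
    Measurable (pathMap : (ℕ → Gex n p) → ℕ → Gex n p) := by
  refine measurable_pi_lambda _ fun m => ?_
  induction m with
  | zero =>
    have : (fun ω : ℕ → Gex n p => pathMap ω 0) = fun ω => ω 0 := by
      funext ω
      simp [pathMap]
    rw [this]
    exact measurable_pi_apply 0
  | succ m ih =>
    have h : Measurable fun q : Gex n p × Gex n p => q.1 * q.2 := measurable_of_countable _
    have h' : (fun ω : ℕ → Gex n p => pathMap ω (m + 1)) =
        (fun q : Gex n p × Gex n p => q.1 * q.2) ∘ fun ω => (pathMap ω m, ω (m + 1)) :=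
      funext fun ω => pathMap_succ ω m
    rw [h']
    exact h.comp (ih.prodMk (measurable_pi_apply (m + 1)))

/-- The path measure of the right random walk: the image of the product measure `μ^ℕ` on
sequences of increments under `pathMap`, which is measurable by `measurable_pathMap`. -/
def pathMeasure {n p : ℕ} [Fact p.Prime] (μ : Measure (Gex n p)) [IsProbabilityMeasure μ] :
    Measure (ℕ → Gex n p) :=
  (Measure.infinitePi fun _ : ℕ => μ).map pathMap

instance {n p : ℕ} [Fact p.Prime] (μ : Measure (Gex n p)) [IsProbabilityMeasure μ] :
    IsProbabilityMeasure (pathMeasure μ) :=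
  Measure.isProbabilityMeasure_map (measurable_pathMap n p).aemeasurable

end SolvableWalk

end

/-! Multiplying the walk by its next increment changes the entry `i j` by the sum over `k < j` of
the old entry `i k`, times `p ^ (y_k - y_j)`, times the entry `k j` of the increment
(`cast_entry_pathMap_succ_sub`). Write `b` for the drift. By the law of large numbers the power of
`p` has norm about `p ^ (m * (b j - b k))`. The entries of the increments grow subexponentially,
since `log⁺` of their norm is at most a constant times the word length and hence integrable.

Let `β` be the minimum of `b` on `[i, j)`. By induction on `l < j`, the entry `i l` grows at most
like `p ^ (m * (b l - β))`: the rates telescope, and because `b l ≥ β` on `[i, j)` the ultrametric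
inequality passes a bound on increments to the entry. At `j` the rate `b j - β` of the increments is
negative; they tend to 0, so the entry is Cauchy in the complete ultrametric field `ℚ_[p]`. -/

namespace SolvableWalk

/-! ### Entries, exponents and word length. -/

section Algebra

variable {n p : ℕ} [Fact p.Prime]

theorem pAdicInt_coe_pUnit_zpow (z : ℤ) :
    (((pUnit p ^ z : (pAdicInt p)ˣ) : pAdicInt p) : ℚ) = (p : ℚ) ^ z := by
  have h : ((Units.map (pAdicInt p).subtype.toMonoidHom (pUnit p ^ z) : ℚˣ) : ℚ) = (p : ℚ) ^ z := by
    rw [map_zpow, Units.val_zpow_eq_zpow_val]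
    rfl
  exact h

theorem expo_mul (i : Fin n) (g h : Gex n p) : expo i (g * h) = expo i g + expo i h := rfl

theorem expo_one (i : Fin n) : expo i (1 : Gex n p) = 0 := rfl

theorem expo_inv (i : Fin n) (g : Gex n p) : expo i g⁻¹ = -expo i g := rfl

theorem entry_self (i : Fin n) (g : Gex n p) : entry i i g = 1 := by
  rw [entry, g.left.2.1 i]
  rfl

theorem entry_of_lt {i j : Fin n} (hij : j < i) (g : Gex n p) : entry i j g = 0 := by
  rw [entry, g.left.2.2 i j hij]
  rfl

theorem entry_mul (i j : Fin n) (g h : Gex n p) :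
    entry i j (g * h) =
      ∑ k, entry i k g * (p : ℚ) ^ (expo k g - expo j g) * entry k j h := by
  have hz : ∀ k, ((zeta n p g.right h.left).val.val k j : pAdicInt p) =
      ((pUnit p ^ (expo k g) : (pAdicInt p)ˣ) : pAdicInt p) * h.left.val.val k j *
        ((pUnit p ^ (-(expo j g)) : (pAdicInt p)ˣ) : pAdicInt p) := by
    intro k
    change (Matrix.diagonal _ * h.left.val.val * Matrix.diagonal _ : Matrix _ _ _) k j = _
    rw [Matrix.mul_diagonal, Matrix.diagonal_mul]
    rfl
  have hm : (g * h).left.val.val i j =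
      ∑ k, g.left.val.val i k * (zeta n p g.right h.left).val.val k j := by
    rw [SemidirectProduct.mul_left, Subgroup.coe_mul, Units.val_mul, Matrix.mul_apply]
  have hp : (p : ℚ) ≠ 0 := Nat.cast_ne_zero.2 (Fact.out : p.Prime).ne_zero
  rw [entry, hm, AddSubmonoidClass.coe_finsetSum]
  refine Finset.sum_congr rfl fun k _ => ?_
  rw [hz, Subring.coe_mul, Subring.coe_mul, Subring.coe_mul, pAdicInt_coe_pUnit_zpow,
    pAdicInt_coe_pUnit_zpow, sub_eq_add_neg, zpow_add₀ hp]
  simp only [entry]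
  ring

theorem abs_single_one_le (a i : Fin n) : |(Pi.single a 1 : Fin n → ℤ) i| ≤ 1 := by
  rw [Pi.single_apply]
  split_ifs <;> simp

theorem abs_expo_le_one_of_mem {s : Gex n p} (hs : s ∈ generators n p) (i : Fin n) :
    |expo i s| ≤ 1 := by
  rcases hs with ⟨-, a, ha⟩ | ⟨h, -⟩
  · rw [expo, ha]
    exact abs_single_one_le a i
  · rw [expo, h]
    simp

theorem abs_expo_le_one {s : Gex n p} (hs : s ∈ generators n p ∨ s⁻¹ ∈ generators n p)
    (i : Fin n) : |expo i s| ≤ 1 := by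
  rcases hs with hs | hs
  · exact abs_expo_le_one_of_mem hs i
  · rw [← abs_neg, ← expo_inv]
    exact abs_expo_le_one_of_mem hs i

theorem left_val_eq_of_mem {s : Gex n p} (hs : s ∈ generators n p ∨ s⁻¹ ∈ generators n p) :
    ∃ M : Matrix (Fin n) (Fin n) ℤ, s.left.val.val = M.map (Int.castRingHom (pAdicInt p)) := by
  have hE : ∀ i j, (Matrix.single i j 1 : Matrix (Fin n) (Fin n) (pAdicInt p)) =
      (Matrix.single i j (1 : ℤ)).map (Int.castRingHom (pAdicInt p)) := by
    intro i j
    rw [Matrix.map_single, map_one]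
  have h1 : (1 : Matrix (Fin n) (Fin n) (pAdicInt p)) =
      (1 : Matrix (Fin n) (Fin n) ℤ).map (Int.castRingHom (pAdicInt p)) := by
    rw [Matrix.map_one _ (map_zero _) (map_one _)]
  rcases hs with (⟨h, -⟩ | ⟨-, i, j, -, h⟩) | (⟨h, -⟩ | ⟨hr, i, j, hij, h⟩)
  · exact ⟨1, by rw [h, ← h1]; rfl⟩
  · refine ⟨1 + Matrix.single i j 1, ?_⟩
    rw [h, Matrix.map_add _ (map_add _), ← hE, ← h1]
  · refine ⟨1, ?_⟩
    rw [← inv_inv s, SemidirectProduct.inv_left, h, inv_one, map_one, ← h1]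
    rfl
  · refine ⟨1 - Matrix.single i j 1, ?_⟩
    rw [← inv_inv s, SemidirectProduct.inv_left, hr, inv_one, map_one, MulAut.one_apply,
      Matrix.map_sub _ (map_sub _), ← hE, ← h1]
    refine Units.inv_eq_of_mul_eq_one_right ?_
    rw [h, add_mul, mul_sub, mul_sub, Matrix.single_mul_single_of_ne _ _ _ _ hij.ne']
    simp

theorem norm_entry_le_one {s : Gex n p} (hs : s ∈ generators n p ∨ s⁻¹ ∈ generators n p)
    (i j : Fin n) : ‖((entry i j s : ℚ) : ℚ_[p])‖ ≤ 1 := by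
  obtain ⟨M, hM⟩ := left_val_eq_of_mem hs
  have : entry i j s = (M i j : ℚ) := by
    rw [entry, hM]
    simp
  rw [this, Rat.cast_intCast]
  exact Padic.norm_int_le_one _

theorem cast_entry_mul (i j : Fin n) (g h : Gex n p) :
    ((entry i j (g * h) : ℚ) : ℚ_[p]) =
      ∑ k, ((entry i k g : ℚ) : ℚ_[p]) * (p : ℚ_[p]) ^ (expo k g - expo j g) *
        ((entry k j h : ℚ) : ℚ_[p]) := by
  rw [entry_mul]
  push_cast
  rfl

theorem abs_expo_prod_le {l : List (Gex n p)}
    (hl : ∀ s ∈ l, s ∈ generators n p ∨ s⁻¹ ∈ generators n p) (i : Fin n) :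
    |expo i l.prod| ≤ l.length := by
  induction l with
  | nil => simp [expo_one]
  | cons s l ih =>
    rw [List.prod_cons, expo_mul]
    have h1 := abs_expo_le_one (hl s (by simp)) i
    have h2 := ih fun t ht => hl t (by simp [ht])
    have h3 := abs_add_le (expo i s) (expo i l.prod)
    push_cast [List.length_cons]
    lia

/-- Each letter costs a factor of at most `p ^ 2`: its entries are integers, and conjugation scales
by `p` to a difference of two exponents in `[-1, 1]`. The ultrametric inequality makes the sum over
`k` free. -/
theorem norm_entry_prod_le {l : List (Gex n p)}
    (hl : ∀ s ∈ l, s ∈ generators n p ∨ s⁻¹ ∈ generators n p) (i j : Fin n) :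
    ‖((entry i j l.prod : ℚ) : ℚ_[p])‖ ≤ ((p : ℝ) ^ 2) ^ l.length := by
  have hp : (1 : ℝ) ≤ p := by exact_mod_cast (Fact.out : p.Prime).one_le
  induction l generalizing i j with
  | nil =>
    have : ∀ i j, entry i j (1 : Gex n p) = (1 : Matrix (Fin n) (Fin n) ℚ) i j := by
      intro i j
      change (((1 : Matrix (Fin n) (Fin n) (pAdicInt p)) i j : pAdicInt p) : ℚ) = _
      rw [Matrix.one_apply, Matrix.one_apply]
      split_ifs <;> rfl
    rw [List.prod_nil, this, Matrix.one_apply]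
    split_ifs <;> simp
  | cons s l ih =>
    rw [List.prod_cons, cast_entry_mul]
    refine IsUltrametricDist.norm_sum_le_of_forall_le_of_nonneg (by positivity) fun k _ => ?_
    have hs := hl s (by simp)
    rw [norm_mul, norm_mul, Padic.norm_p_zpow, List.length_cons, pow_succ']
    have h1 : (p : ℝ) ^ (-(expo k s - expo j s)) ≤ (p : ℝ) ^ 2 := by
      rw [← zpow_natCast]
      refine zpow_le_zpow_right₀ hp ?_
      have := abs_le.1 (abs_expo_le_one hs k)
      have := abs_le.1 (abs_expo_le_one hs j)
      push_cast
      lia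
    calc _ ≤ 1 * (p : ℝ) ^ 2 * ((p : ℝ) ^ 2) ^ l.length := by
          gcongr
          · exact norm_entry_le_one hs i k
          · exact ih (fun t ht => hl t (by simp [ht])) k j
      _ = _ := by rw [one_mul]

/-- If no word represents `g`, the length is `⊤` and the bound is vacuous, so it is not necessary to
know that `S` generates the group. -/
theorem ofReal_le_wordLength {G : Type*} [Group G] {S : Set G} {g : G} {r : ℝ}
    (h : ∀ l : List G, (∀ s ∈ l, s ∈ S ∨ s⁻¹ ∈ S) → l.prod = g → r ≤ l.length) :
    ENNReal.ofReal r ≤ (wordLength S g : ℝ≥0∞) := by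
  have h1 : ((⌈r⌉₊ : ℕ) : ℕ∞) ≤ wordLength S g :=
    le_iInf₂ fun l hl => by exact_mod_cast Nat.ceil_le.2 (h l hl.1 hl.2)
  calc ENNReal.ofReal r ≤ ((⌈r⌉₊ : ℕ) : ℝ≥0∞) := by
        rw [← ENNReal.ofReal_natCast]
        exact ENNReal.ofReal_le_ofReal (Nat.le_ceil r)
    _ = (((⌈r⌉₊ : ℕ) : ℕ∞) : ℝ≥0∞) := by simp
    _ ≤ _ := ENat.toENNReal_le.2 h1

theorem integrable_of_abs_le_wordLength {μ : Measure (Gex n p)} (hμ : FiniteFirstMoment μ)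
    {f : Gex n p → ℝ} (h : ∀ l : List (Gex n p),
      (∀ s ∈ l, s ∈ generators n p ∨ s⁻¹ ∈ generators n p) → |f l.prod| ≤ l.length) :
    Integrable f μ := by
  refine ⟨(measurable_of_countable f).aestronglyMeasurable, ?_⟩
  refine (lintegral_mono fun g => ?_).trans_lt hμ
  rw [← ofReal_norm, Real.norm_eq_abs]
  exact ofReal_le_wordLength fun l hl hg => hg ▸ h l hl

theorem integrable_expo {μ : Measure (Gex n p)} (hμ : FiniteFirstMoment μ) (i : Fin n) :
    Integrable (fun g => (expo i g : ℝ)) μ :=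
  integrable_of_abs_le_wordLength hμ fun l hl => by
    exact_mod_cast abs_expo_prod_le hl i

theorem integrable_posLog_norm_entry {μ : Measure (Gex n p)} (hμ : FiniteFirstMoment μ)
    (i j : Fin n) : Integrable (fun g => Real.posLog ‖((entry i j g : ℚ) : ℚ_[p])‖) μ := by
  have hp : (1 : ℝ) < p := by exact_mod_cast (Fact.out : p.Prime).one_lt
  have hc : 0 < Real.log ((p : ℝ) ^ 2) := Real.log_pos (one_lt_pow₀ hp two_ne_zero)
  have key : Integrable (fun g => Real.posLog ‖((entry i j g : ℚ) : ℚ_[p])‖ /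
      Real.log ((p : ℝ) ^ 2)) μ := by
    refine integrable_of_abs_le_wordLength hμ fun l hl => ?_
    rw [abs_of_nonneg (div_nonneg Real.posLog_nonneg hc.le), div_le_iff₀ hc, ← Real.log_pow,
      Real.posLog_eq_log_max_one (norm_nonneg _)]
    exact Real.log_le_log (by positivity)
      (max_le (one_le_pow₀ (one_le_pow₀ hp.le)) (norm_entry_prod_le hl i j))
  refine (key.mul_const (Real.log ((p : ℝ) ^ 2))).congr (ae_of_all _ fun g => ?_)
  exact div_mul_cancel₀ _ hc.ne'

theorem drift_eq_integral (μ : Measure (Gex n p)) (i : Fin n) :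
    drift μ i = ∫ g, (expo i g : ℝ) ∂μ :=
  integral_map (measurable_of_countable _).aemeasurable
    (measurable_of_countable _).aestronglyMeasurable

end Algebra

/-! ### Exponential growth rates. -/

section Rate

/-- The exponential growth rate of the sequence `A` is at most `c`. -/
def ExpRate {E : Type*} [Norm E] (A : ℕ → E) (c : ℝ) : Prop :=
  ∀ ε > 0, A =O[atTop] fun m : ℕ => Real.exp ((c + ε) * m)

theorem ExpRate.mono {E : Type*} [Norm E] {A : ℕ → E} {c d : ℝ} (h : ExpRate A c)
    (hcd : c ≤ d) : ExpRate A d := by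
  intro ε hε
  have h' := h (d - c + ε) (by linarith)
  rwa [← add_assoc, add_sub_cancel] at h'

theorem ExpRate.zero {E : Type*} [SeminormedAddCommGroup E] (c : ℝ) :
    ExpRate (fun _ => (0 : E)) c :=
  fun _ _ => Asymptotics.isBigO_zero _ _

theorem ExpRate.mul {R : Type*} [SeminormedRing R] {A B : ℕ → R} {c d : ℝ}
    (hA : ExpRate A c) (hB : ExpRate B d) : ExpRate (fun m => A m * B m) (c + d) := by
  intro ε hε
  refine ((hA (ε / 2) (by linarith)).mul (hB (ε / 2) (by linarith))).congr_right fun m => ?_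
  rw [← Real.exp_add]
  congr 1
  ring

theorem ExpRate.sum {ι E : Type*} [SeminormedAddCommGroup E] {s : Finset ι} {A : ι → ℕ → E}
    {c : ℝ} (h : ∀ i ∈ s, ExpRate (A i) c) : ExpRate (fun m => ∑ i ∈ s, A i m) c :=
  fun ε hε => Asymptotics.IsBigO.fun_sum fun i hi => h i hi ε hε

theorem expRate_of_norm_le_exp {E : Type*} [Norm E] {A : ℕ → E} {u : ℕ → ℝ} {c : ℝ}
    (h : ∀ m, ‖A m‖ ≤ Real.exp (u m)) (hu : Tendsto (fun m : ℕ => u m / m) atTop (𝓝 c)) :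
    ExpRate A c := by
  intro ε hε
  refine Asymptotics.IsBigO.of_bound 1 ?_
  filter_upwards [hu.eventually_lt_const (show c < c + ε by linarith), eventually_gt_atTop 0]
    with m hm hm0
  have hm0' : (0 : ℝ) < m := by exact_mod_cast hm0
  rw [one_mul, Real.norm_eq_abs, Real.abs_exp]
  exact (h m).trans (Real.exp_le_exp.2 ((div_lt_iff₀ hm0').1 hm).le)

/-- In an ultrametric group `A m` is no larger than `A 0` and the largest earlier increment. The
condition `0 ≤ c` makes the bounds `exp ((c + ε) * m)` nondecreasing, so the latest one dominates.
-/
theorem expRate_of_expRate_sub {E : Type*} [SeminormedAddCommGroup E] [IsUltrametricDist E]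
    {A : ℕ → E} {c : ℝ} (hc : 0 ≤ c) (h : ExpRate (fun m => A (m + 1) - A m) c) :
    ExpRate A c := by
  intro ε hε
  -- As the exponential never vanishes, the bound holds for every `m`, not only eventually.
  obtain ⟨C, hC, hb⟩ := Asymptotics.bound_of_isBigO_nat_atTop (h ε hε)
  refine Asymptotics.IsBigO.of_bound (max C ‖A 0‖) (Eventually.of_forall fun m => ?_)
  rw [Real.norm_eq_abs, Real.abs_exp]
  induction m with
  | zero => simp
  | succ m ih =>
    have h1 := hb (x := m) (Real.exp_ne_zero _)
    rw [Real.norm_eq_abs, Real.abs_exp] at h1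
    have h2 : Real.exp ((c + ε) * m) ≤ Real.exp ((c + ε) * ((m + 1 : ℕ) : ℝ)) := by
      gcongr
      exact Nat.le_succ m
    have h3 : 0 ≤ max C ‖A 0‖ := hC.le.trans (le_max_left _ _)
    calc ‖A (m + 1)‖ = ‖(A (m + 1) - A m) + A m‖ := by rw [sub_add_cancel]
      _ ≤ max ‖A (m + 1) - A m‖ ‖A m‖ := IsUltrametricDist.norm_add_le_max _ _
      _ ≤ max C ‖A 0‖ * Real.exp ((c + ε) * m) :=
        max_le (h1.trans (by gcongr; exact le_max_left _ _)) ih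
      _ ≤ _ := by gcongr

theorem ExpRate.tendsto_zero {E : Type*} [NormedAddCommGroup E] {A : ℕ → E} {c : ℝ}
    (hc : c < 0) (h : ExpRate A c) : Tendsto A atTop (𝓝 0) := by
  refine (h (-c / 2) (by linarith)).trans_tendsto ?_
  refine Real.tendsto_exp_atBot.comp ?_
  exact tendsto_natCast_atTop_atTop.const_mul_atTop_of_neg (by linarith)

/-- Place `m` of the path has `m + 1` factors; this absorbs the shift. -/
theorem tendsto_succ_div {S : ℕ → ℝ} {l : ℝ}
    (h : Tendsto (fun m : ℕ => S m / m) atTop (𝓝 l)) :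
    Tendsto (fun m : ℕ => S (m + 1) / m) atTop (𝓝 l) := by
  have h1 := (h.comp (tendsto_add_atTop_nat 1)).mul (tendsto_const_nhds.add
    (tendsto_one_div_atTop_nhds_zero_nat (𝕜 := ℝ)) : Tendsto _ _ (𝓝 ((1 : ℝ) + 0)))
  rw [add_zero, mul_one] at h1
  refine h1.congr' ?_
  filter_upwards [eventually_gt_atTop 0] with m hm
  have : (m : ℝ) ≠ 0 := by exact_mod_cast hm.ne'
  have h' : (m : ℝ) + 1 ≠ 0 := by positivity
  simp only [Function.comp_apply]
  push_cast
  field_simp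

theorem tendsto_term_div {x : ℕ → ℝ} {l : ℝ}
    (h : Tendsto (fun m : ℕ => (∑ t ∈ Finset.range m, x t) / m) atTop (𝓝 l)) :
    Tendsto (fun m : ℕ => x (m + 1) / m) atTop (𝓝 0) := by
  have h1 := tendsto_succ_div h
  have h2 := tendsto_succ_div h1
  have h3 := h2.sub h1
  rw [sub_self] at h3
  refine h3.congr fun m => ?_
  rw [← sub_div, Finset.sum_range_succ _ (m + 1), add_sub_cancel_left]

end Rate

/-! ### Growth of the entries along the walk, and almost sure regularity. -/

section Walk

variable {n p : ℕ} [Fact p.Prime]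

theorem expo_pathMap (i : Fin n) (ω : ℕ → Gex n p) (m : ℕ) :
    expo i (pathMap ω m) = ∑ t ∈ Finset.range (m + 1), expo i (ω t) := by
  induction m with
  | zero => simp [pathMap]
  | succ m ih => rw [pathMap_succ, expo_mul, ih, Finset.sum_range_succ _ (m + 1)]

/-- In the product formula the term `k = j` is the old entry, and the terms `k > j` vanish by
triangularity. -/
theorem cast_entry_pathMap_succ_sub (i j : Fin n) (ω : ℕ → Gex n p) (m : ℕ) :
    ((entry i j (pathMap ω (m + 1)) : ℚ) : ℚ_[p]) - ((entry i j (pathMap ω m) : ℚ) : ℚ_[p]) =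
      ∑ k ∈ Finset.Iio j, ((entry i k (pathMap ω m) : ℚ) : ℚ_[p]) *
        (p : ℚ_[p]) ^ (expo k (pathMap ω m) - expo j (pathMap ω m)) *
        ((entry k j (ω (m + 1)) : ℚ) : ℚ_[p]) := by
  have hs : (Finset.Iio j ∪ {j} : Finset (Fin n)) = Finset.Iic j := by
    ext k
    simp [le_iff_lt_or_eq, or_comm]
  rw [pathMap_succ, cast_entry_mul, ← Finset.sum_subset (Finset.subset_univ (Finset.Iic j)),
    ← hs, Finset.sum_union (by simp), Finset.sum_singleton, entry_self, sub_self, zpow_zero,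
    Rat.cast_one, mul_one, mul_one, add_sub_cancel_right]
  intro k _ hk
  rw [entry_of_lt (by simpa using hk) (ω (m + 1)), Rat.cast_zero, mul_zero]

/-- The law of large numbers for the exponents of the increments `ω`, with drift `b`, together
with subexponential growth of the entries of the increments. -/
structure Regular (b : Fin n → ℝ) (ω : ℕ → Gex n p) : Prop where
  expo : ∀ i, Tendsto (fun m : ℕ => (∑ t ∈ Finset.range m, (expo i (ω t) : ℝ)) / m) atTop (𝓝 (b i))
  entry : ∀ i j, Tendsto (fun m : ℕ =>
    Real.posLog ‖((entry i j (ω (m + 1)) : ℚ) : ℚ_[p])‖ / m) atTop (𝓝 0)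

variable {b : Fin n → ℝ} {ω : ℕ → Gex n p}

theorem Regular.expRate_entry (h : Regular b ω) (i j : Fin n) :
    ExpRate (fun m => ((SolvableWalk.entry i j (ω (m + 1)) : ℚ) : ℚ_[p])) 0 := by
  refine expRate_of_norm_le_exp (fun m => ?_) (h.entry i j)
  rw [Real.posLog_eq_log_max_one (norm_nonneg _), Real.exp_log (by positivity)]
  exact le_max_right _ _

theorem Regular.expRate_zpow (h : Regular b ω) (i j : Fin n) :
    ExpRate (fun m => (p : ℚ_[p]) ^ (SolvableWalk.expo i (pathMap ω m) -
      SolvableWalk.expo j (pathMap ω m))) ((b j - b i) * Real.log p) := by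
  have hp : (0 : ℝ) < p := by exact_mod_cast (Fact.out : p.Prime).pos
  have h1 := ((tendsto_succ_div (h.expo j)).sub (tendsto_succ_div (h.expo i))).mul_const (Real.log p)
  refine expRate_of_norm_le_exp (u := fun m => ((∑ t ∈ Finset.range (m + 1),
    (SolvableWalk.expo j (ω t) : ℝ)) - ∑ t ∈ Finset.range (m + 1),
    (SolvableWalk.expo i (ω t) : ℝ)) * Real.log p) (fun m => ?_) (h1.congr fun m => by ring)
  rw [Padic.norm_p_zpow, ← Real.rpow_intCast, Real.rpow_def_of_pos hp, expo_pathMap, expo_pathMap]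
  refine Real.exp_le_exp.2 (le_of_eq ?_)
  push_cast
  ring

/-- If each entry `i k` with `k < l` grows at most at the rate `b k - β` (in base `p`), then the
increments of the entry `i l` grow at most at the rate `b l - β`. -/
theorem Regular.expRate_sub (h : Regular b ω) {i l : Fin n} {β : ℝ}
    (hA : ∀ k < l, ExpRate (fun m => ((SolvableWalk.entry i k (pathMap ω m) : ℚ) : ℚ_[p]))
      ((b k - β) * Real.log p)) :
    ExpRate (fun m => ((SolvableWalk.entry i l (pathMap ω (m + 1)) : ℚ) : ℚ_[p]) -
      ((SolvableWalk.entry i l (pathMap ω m) : ℚ) : ℚ_[p])) ((b l - β) * Real.log p) := by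
  simp only [cast_entry_pathMap_succ_sub]
  refine ExpRate.sum fun k hk => ?_
  -- The rates telescope: `(b k - β) + (b l - b k) + 0 = b l - β`.
  refine (((hA k (Finset.mem_Iio.1 hk)).mul (h.expRate_zpow k l)).mul
    (h.expRate_entry k l)).mono (le_of_eq ?_)
  ring

/-- Strong induction on `l`. Entries with `l < i` are zero and satisfy any rate, even a negative
one; hence `β` need only bound `b` from below on `[i, j)`. -/
theorem Regular.expRate_entry_pathMap (h : Regular b ω) {i j : Fin n} {β : ℝ}
    (hβ : ∀ k, i ≤ k → k < j → β ≤ b k) (l : Fin n) (hl : l < j) :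
    ExpRate (fun m => ((SolvableWalk.entry i l (pathMap ω m) : ℚ) : ℚ_[p]))
      ((b l - β) * Real.log p) := by
  induction l using WellFoundedLT.induction with
  | ind l ih =>
    rcases lt_or_ge l i with hli | hli
    · simp only [entry_of_lt hli, Rat.cast_zero]
      exact ExpRate.zero _
    · refine expRate_of_expRate_sub (mul_nonneg (sub_nonneg.2 (hβ l hli hl)) ?_)
        (h.expRate_sub fun k hk => ih k hk (hk.trans hl))
      exact Real.log_natCast_nonneg p

theorem Regular.exists_tendsto (h : Regular b ω) {i j : Fin n} (hij : i < j)
    (hb : ∀ k, i ≤ k → k < j → b j < b k) :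
    ∃ L : ℚ_[p], Tendsto (fun m => ((SolvableWalk.entry i j (pathMap ω m) : ℚ) : ℚ_[p]))
      atTop (𝓝 L) := by
  -- With `β = b a` the minimum, every rate before `j` is nonnegative, while the one at `j` is
  -- negative because `b j < b a`.
  obtain ⟨a, ha, hmin⟩ := (Finset.Ico i j).exists_min_image b ⟨i, by simp [hij]⟩
  rw [Finset.mem_Ico] at ha
  refine cauchySeq_tendsto_of_complete
    (NonarchimedeanAddGroup.cauchySeq_of_tendsto_sub_nhds_zero ?_)
  refine (h.expRate_sub (β := b a) fun k hk => h.expRate_entry_pathMap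
    (fun k hik hkj => hmin k (Finset.mem_Ico.2 ⟨hik, hkj⟩)) k hk).tendsto_zero ?_
  refine mul_neg_of_neg_of_pos (sub_neg.2 (hb a ha.1 ha.2)) (Real.log_pos ?_)
  exact_mod_cast (Fact.out : p.Prime).one_lt

/-- The increments of a path. -/
def increments {G : Type*} [Group G] (φ : ℕ → G) : ℕ → G
  | 0 => φ 0
  | m + 1 => (φ m)⁻¹ * φ (m + 1)

theorem pathMap_increments {G : Type*} [Group G] (φ : ℕ → G) : pathMap (increments φ) = φ := by
  funext m
  induction m with
  | zero => simp [pathMap, increments]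
  | succ m ih => rw [pathMap_succ, ih, increments, mul_inv_cancel_left]

theorem increments_pathMap {G : Type*} [Group G] (ω : ℕ → G) : increments (pathMap ω) = ω := by
  funext m
  cases m with
  | zero => simp [pathMap, increments]
  | succ m => rw [increments, pathMap_succ, inv_mul_cancel_left]

theorem measurable_increments (n p : ℕ) [Fact p.Prime] :
    Measurable (increments : (ℕ → Gex n p) → ℕ → Gex n p) := by
  refine measurable_pi_lambda _ fun m => ?_
  cases m with
  | zero => exact measurable_pi_apply 0
  | succ m =>
    have h : Measurable fun q : Gex n p × Gex n p => q.1⁻¹ * q.2 := measurable_of_countable _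
    have h' : (fun φ : ℕ → Gex n p => increments φ (m + 1)) =
        (fun q : Gex n p × Gex n p => q.1⁻¹ * q.2) ∘ fun φ => (φ m, φ (m + 1)) := rfl
    rw [h']
    exact h.comp ((measurable_pi_apply m).prodMk (measurable_pi_apply (m + 1)))

/-- Pulling back along the inverse `increments`, rather than pushing along `pathMap`, avoids any
measurability condition on `Q`. -/
theorem ae_pathMeasure_of_ae_infinitePi (μ : Measure (Gex n p)) [IsProbabilityMeasure μ]
    {Q : (ℕ → Gex n p) → Prop}
    (h : ∀ᵐ ω ∂(Measure.infinitePi fun _ : ℕ => μ), Q (pathMap ω)) :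
    ∀ᵐ φ ∂(pathMeasure μ), Q φ := by
  have h1 : (pathMeasure μ).map increments = Measure.infinitePi fun _ : ℕ => μ := by
    have h2 : (increments ∘ pathMap : (ℕ → Gex n p) → ℕ → Gex n p) = id :=
      funext increments_pathMap
    rw [pathMeasure, Measure.map_map (measurable_increments n p) (measurable_pathMap n p), h2,
      Measure.map_id]
  rw [← h1] at h
  simpa only [pathMap_increments] using ae_of_ae_map (measurable_increments n p).aemeasurable h

theorem ae_tendsto_sum_div (μ : Measure (Gex n p)) [IsProbabilityMeasure μ] {f : Gex n p → ℝ}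
    (hf : Integrable f μ) :
    ∀ᵐ ω ∂(Measure.infinitePi fun _ : ℕ => μ),
      Tendsto (fun m : ℕ => (∑ t ∈ Finset.range m, f (ω t)) / m) atTop (𝓝 (∫ g, f g ∂μ)) := by
  have hm : Measurable f := measurable_of_countable f
  have hev : ∀ t : ℕ, MeasurePreserving (fun ω : ℕ → Gex n p => ω t)
      (Measure.infinitePi fun _ : ℕ => μ) μ := fun t => measurePreserving_eval_infinitePi _ t
  have hid : ∀ t, ProbabilityTheory.IdentDistrib (fun ω : ℕ → Gex n p => f (ω t)) f
      (Measure.infinitePi fun _ : ℕ => μ) μ := fun t =>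
    { aemeasurable_fst := (hm.comp (hev t).measurable).aemeasurable
      aemeasurable_snd := hm.aemeasurable
      map_eq := by
        conv_rhs => rw [← (hev t).map_eq, Measure.map_map hm (hev t).measurable]
        rfl }
  have h := ProbabilityTheory.strong_law_ae_real (μ := Measure.infinitePi fun _ : ℕ => μ)
    (fun t ω => f (ω t)) ((hid 0).integrable_iff.2 hf)
    (fun s t hst => (ProbabilityTheory.iIndepFun_infinitePi (X := fun _ => f)
      fun _ => hm).indepFun hst)
    (fun t => (hid t).trans (hid 0).symm)
  rwa [(hid 0).integral_eq] at h

theorem ae_regular (μ : Measure (Gex n p)) [IsProbabilityMeasure μ]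
    (hμ : FiniteFirstMoment μ) :
    ∀ᵐ ω ∂(Measure.infinitePi fun _ : ℕ => μ), Regular (drift μ) ω := by
  have h1 := ae_all_iff.2 fun i => ae_tendsto_sum_div μ (integrable_expo hμ i)
  have h2 := ae_all_iff.2 fun i => ae_all_iff.2 fun j =>
    ae_tendsto_sum_div μ (integrable_posLog_norm_entry hμ i j)
  filter_upwards [h1, h2] with ω hω1 hω2
  -- Convergent averages of `log⁺` force its single terms to be `o(m)`.
  refine ⟨fun i => ?_, fun i j => tendsto_term_div (hω2 i j)⟩
  rw [drift_eq_integral]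
  exact hω1 i

theorem ae_exists_tendsto (μ : Measure (Gex n p)) [IsProbabilityMeasure μ]
    (hμ : FiniteFirstMoment μ) {i j : Fin n} (hij : i < j)
    (h : ∀ k, i ≤ k → k < j → drift μ j < drift μ k) :
    ∀ᵐ φ ∂(pathMeasure μ), ∃ L : ℚ_[p],
      Tendsto (fun m => ((entry i j (φ m) : ℚ) : ℚ_[p])) atTop (𝓝 L) := by
  refine ae_pathMeasure_of_ae_infinitePi μ ?_
  filter_upwards [ae_regular μ hμ] with ω hω
  exact hω.exists_tendsto hij h

theorem exists_mem_UT {K : Type*} [Field K] (L : Fin n → Fin n → K) :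
    ∃ Φ : UT n K, ∀ i j, i < j → Φ.val.val i j = L i j := by
  let M : Matrix (Fin n) (Fin n) K :=
    Matrix.of fun i j => if i < j then L i j else if i = j then 1 else 0
  have hd : ∀ i, M i i = 1 := fun i => by simp [M]
  have ht : ∀ i j, j < i → M i j = 0 := fun i j hij => by simp [M, hij.not_gt, hij.ne']
  have hdet : M.det ≠ 0 := by
    rw [Matrix.det_of_isUpperTriangular fun i j hij => ht i j hij]
    simp [hd]
  exact ⟨⟨Matrix.GeneralLinearGroup.mkOfDetNeZero M hdet, hd, ht⟩, fun i j hij => if_pos hij⟩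

end Walk

end SolvableWalk

/-! ### From signs of displacements to inequalities between drifts. -/

theorem mainTheorem6 (n p : ℕ) [Fact p.Prime] (μ : Measure (SolvableWalk.Gex n p))
    [IsProbabilityMeasure μ] (hmoment : SolvableWalk.FiniteFirstMoment μ)
    (hsupp : SolvableWalk.NonAbelianSupport μ) :
    (∀ i j : Fin n, i < j → 0 < SolvableWalk.displacement μ i j →
      (∀ k, i < k → k < j → SignType.sign (SolvableWalk.displacement μ i j) =
        SignType.sign (SolvableWalk.displacement μ k j)) →
      ∀ᵐ φ ∂(SolvableWalk.pathMeasure μ), ∃ L : ℚ_[p],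
        Tendsto (fun m => ((SolvableWalk.entry i j (φ m) : ℚ) : ℚ_[p])) atTop (𝓝 L)) ∧
    ((∀ i j : Fin n, i < j → 0 < SolvableWalk.displacement μ i j) →
      ∀ᵐ φ ∂(SolvableWalk.pathMeasure μ), ∃ Φ : SolvableWalk.UT n ℚ_[p], ∀ i j : Fin n,
        Tendsto (fun m => ((SolvableWalk.entry i j (φ m) : ℚ) : ℚ_[p])) atTop
          (𝓝 (Φ.val.val i j))) := by
  constructor
  · intro i j hij hD hsgn
    refine SolvableWalk.ae_exists_tendsto μ hmoment hij fun k hik hkj => ?_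
    -- For `k = i` the inequality is the positivity of `D_{ij}`; for the other `k` the sign
    -- condition transfers it.
    rcases hik.eq_or_lt with rfl | hik
    · exact sub_pos.1 hD
    · have h := hsgn k hik hkj
      rw [sign_pos hD] at h
      exact sub_pos.1 (sign_eq_one_iff.1 h.symm)
  · intro hD
    have h : ∀ᵐ φ ∂(SolvableWalk.pathMeasure μ), ∀ i j : Fin n, i < j → ∃ L : ℚ_[p],
        Tendsto (fun m => ((SolvableWalk.entry i j (φ m) : ℚ) : ℚ_[p])) atTop (𝓝 L) := by
      refine ae_all_iff.2 fun i => ae_all_iff.2 fun j => ?_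
      by_cases hij : i < j
      · filter_upwards [SolvableWalk.ae_exists_tendsto μ hmoment hij
          fun k _ hkj => sub_pos.1 (hD k j hkj)] with φ hφ _
        exact hφ
      · exact ae_of_all _ fun φ h => absurd h hij
    filter_upwards [h] with φ hφ
    choose! L hL using hφ
    obtain ⟨Φ, hΦ⟩ := SolvableWalk.exists_mem_UT L
    refine ⟨Φ, fun i j => ?_⟩
    rcases lt_trichotomy i j with hij | rfl | hij
    · rw [hΦ i j hij]
      exact hL i j hij
    · simp only [SolvableWalk.entry_self, Φ.2.1 i, Rat.cast_one]
      exact tendsto_const_nhds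
    · simp only [SolvableWalk.entry_of_lt hij, Φ.2.2 i j hij, Rat.cast_zero]
      exact tendsto_const_nhds
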